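/- Let $F$ be a field of prime characteristic $p$, let $V$ be a vector space over $F$ (of any dimension), and let $r\ge 1$. **Filtration.** Let $T^r(V)$ be the $r$th homogeneous component of the tensor algebra $T(V)$, let $L(V)$ be the Lie subalgebra of $T(V)$ generated by $V$ (under $[a,b]=ab-ba$), and put $L^i(V)=T^i(V)\cap L(V)$. For a partition $\lambda$ of $r$ let $\mathcal X_\lambda\subseteq T^r(V)$ be the set of all products $b_1\cdots b_l$ with $b_i\in L^{\mu_i}(V)$, where $(\mu_1,\dots,\mu_l)$ is a composition of $r$ (a sequence of positive integers with sum $r$) whose non-increasing rearrangement is $\lambda$. Order the partitions of $r$ (written with non-increasing parts) lexicographically by $\le^*$, and let $W_\lambda$ and $W_{\lambda+}$ be the subspaces of $T^r(V)$ spanned by all $\mathcal X_\theta$ with $\lambda\le^*\theta$ and with $\lambda<^*\theta$, respectively (so $W_{(r)+}=0$). **Descent algebra.** Multiply permutations of $\{1,\dots,r\}$ from left to right and write $i\sigma$ for the image of $i$ under $\sigma$; then $\mathrm{Sym}(r)$, and by linearity $F\,\mathrm{Sym}(r)$, acts on $T^r(V)$ from the left by $\sigma(v_1\cdots v_r)=v_{1\sigma}\cdots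 v_{r\sigma}$. For a composition $\nu=(\nu_1,\dots,\nu_k)$ of $r$ let $X^\nu\in F\,\mathrm{Sym}(r)$ be the sum of all $\sigma$ such that $i\sigma<(i+1)\sigma$ for every $i\in\{1,\dots,r-1\}$ that is not one of the partial sums $\nu_1+\cdots+\nu_j$. The $X^\nu$ are linearly independent; their span is the descent algebra $D_{r,F}$. Let $\phi^\nu$ be the character (in characteristic $0$) of $\mathrm{Sym}(r)$ induced from the trivial character of $\mathrm{Sym}(\nu_1)\times\cdots\times\mathrm{Sym}(\nu_k)$, and let $c_{r,F}$ be the $F$-linear map from $D_{r,F}$ to the class functions $\mathrm{Sym}(r)\to F$ with $c_{r,F}(X^\nu)=\phi^\nu\cdot 1_F$ for all $\nu$. For a class function $\xi$ write $\xi(\lambda)$ for its value on the permutations of cycle type $\lambda$. **Idempotents.** Partitions $\lambda,\theta$ of $r$ are $p$-equivalent if, for permutations $\sigma_\lambda,\sigma_\theta$ of cycle types $\lambda,\theta$, the elements $\sigma_\lambda^{p^s}$ and $\sigma_\theta^{p^s}$ are conjugate for some integer $s\ge1$. Let $\mathcal J$ be the set of $p$-equivalence classes, and let $(e_J)_{J\in\mathcal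 J}$ be pairwise orthogonal primitive idempotents of $D_{r,F}$ with $\sum_{J\in\mathcal J} e_J=1$ and such that $(c_{r,F}(e_J))(\lambda)$ is $1$ if $\lambda\in J$ and $0$ if $\lambda\notin J$. **Lifted bases.** For each partition $\lambda$ of $r$ let $\mathcal Y_\lambda$ be any subset of $W_\lambda$ such that the cosets $y+W_{\lambda+}$ $(y\in\mathcal Y_\lambda)$ are distinct and form a basis of $W_\lambda/W_{\lambda+}$. For $J\in\mathcal J$ put $\mathcal Y_J=\bigcup_{\lambda\in J}\mathcal Y_\lambda$ and let $Y_J$ be the subspace of $T^r(V)$ spanned by $\mathcal Y_J$. **Proposition 3.5.** For every $J\in\mathcal J$, the set $\mathcal Y_J$ is a basis of $Y_J$, and the map $\phi_J:T^r(V)\to e_JT^r(V)$, $\phi_J(w)=e_Jw$, restricts to a vector space isomorphism from $Y_J$ onto $e_JT^r(V)$. Thus $e_J\mathcal Y_J$ is a basis of $e_JT^r(V)$; more precisely, the elements $e_Jy$ $(y\in\mathcal Y_J)$ are distinct and form a basis of $e_JT^r(V)$. -/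

import Mathlib

open scoped TensorProduct

namespace DescentPBW

/-! ### Partitions and compositions -/

/-- The `i`-th part (counted from `0`) of a partition written in non-increasing order,
and `0` when `i` is beyond the last part. -/
def part {r : ℕ} (lam : r.Partition) (i : ℕ) : ℕ :=
  (lam.parts.sort (· ≥ ·)).getD i 0

/-- The strict lexicographic order on the partitions of `r`. -/
def LexLT {r : ℕ} (lam theta : r.Partition) : Prop :=
  ∃ i, part lam i < part theta i ∧ ∀ j < i, part lam j = part theta j

/-- The lexicographic order on the partitions of `r`. -/
def LexLE {r : ℕ} (lam theta : r.Partition) : Prop :=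
  lam = theta ∨ LexLT lam theta

/-- The partition of `r` that indexes the conjugacy class of `σ` in `Sym(r)`: the lengths of all
the cycles of `σ`, fixed points included. -/
def cyclePartition {r : ℕ} (σ : Equiv.Perm (Fin r)) : r.Partition where
  parts := σ.partition.parts
  parts_pos := σ.partition.parts_pos
  parts_sum := σ.partition.parts_sum.trans (Fintype.card_fin r)

/-- Two partitions `lam`, `theta` of `r` are `p`-equivalent if, for permutations `σ`, `τ` in the
corresponding conjugacy classes, `σ ^ (p ^ s)` and `τ ^ (p ^ s)` are conjugate for some positive
integer `s`. -/
def PEquiv (p : ℕ) {r : ℕ} (lam theta : r.Partition) : Prop :=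
  ∃ σ τ : Equiv.Perm (Fin r), cyclePartition σ = lam ∧ cyclePartition τ = theta ∧
    ∃ s : ℕ, 0 < s ∧ IsConj (σ ^ p ^ s) (τ ^ p ^ s)

lemma isConj_of_cyclePartition_eq {r : ℕ} {σ τ : Equiv.Perm (Fin r)}
    (h : cyclePartition σ = cyclePartition τ) : IsConj σ τ := by
  rw [Equiv.Perm.partition_eq_of_isConj]
  have hp : (cyclePartition σ).parts = (cyclePartition τ).parts := by rw [h]
  exact Nat.Partition.ext hp

lemma exists_cyclePartition_eq {r : ℕ} (lam : r.Partition) :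
    ∃ σ : Equiv.Perm (Fin r), cyclePartition σ = lam := by
  classical
  have hsplit : lam.parts.filter (2 ≤ ·) + lam.parts.filter (¬ 2 ≤ ·) = lam.parts :=
    Multiset.filter_add_not _ _
  have hone : lam.parts.filter (¬ 2 ≤ ·)
      = Multiset.replicate (lam.parts.filter (¬ 2 ≤ ·)).card 1 := by
    refine Multiset.eq_replicate_card.2 fun b hb => ?_
    rw [Multiset.mem_filter] at hb
    have := lam.parts_pos hb.1
    omega
  have hsum := congrArg Multiset.sum hsplit
  rw [Multiset.sum_add, lam.parts_sum] at hsum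
  obtain ⟨σ, hσ⟩ := (Equiv.Perm.exists_with_cycleType_iff (Fin r)
    (m := lam.parts.filter (2 ≤ ·))).2
      ⟨by rw [Fintype.card_fin]; omega, fun a ha => (Multiset.mem_filter.1 ha).2⟩
  refine ⟨σ, Nat.Partition.ext ?_⟩
  change σ.cycleType + Multiset.replicate (Fintype.card (Fin r) - σ.support.card) 1 = lam.parts
  have hs : (lam.parts.filter (¬ 2 ≤ ·)).sum = (lam.parts.filter (¬ 2 ≤ ·)).card := by
    conv_lhs => rw [hone]
    simp
  rw [← Equiv.Perm.sum_cycleType, hσ, Fintype.card_fin]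
  conv_rhs => rw [← hsplit, hone]
  congr 2
  omega

lemma isConj_pow {G : Type*} [Group G] {a b : G} (h : IsConj a b) (n : ℕ) :
    IsConj (a ^ n) (b ^ n) := by
  obtain ⟨c, hc⟩ := isConj_iff.1 h
  exact isConj_iff.2 ⟨c, by rw [← hc, conj_pow]⟩

lemma pEquiv_equivalence (p r : ℕ) : Equivalence (PEquiv p (r := r)) where
  refl lam := by
    obtain ⟨σ, hσ⟩ := exists_cyclePartition_eq lam
    exact ⟨σ, σ, hσ, hσ, 1, one_pos, IsConj.refl _⟩
  symm := by
    rintro lam theta ⟨σ, τ, hσ, hτ, s, hs, h⟩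
    exact ⟨τ, σ, hτ, hσ, s, hs, h.symm⟩
  trans := by
    rintro lam theta eta ⟨σ, τ, hσ, hτ, s, hs, h⟩ ⟨τ', ρ, hτ', hρ, t, ht, h'⟩
    have hc : IsConj τ τ' := isConj_of_cyclePartition_eq (hτ.trans hτ'.symm)
    refine ⟨σ, ρ, hσ, hρ, s + t, by omega, ?_⟩
    have h1 := isConj_pow h (p ^ t)
    have h2 := isConj_pow h' (p ^ s)
    rw [← pow_mul, ← pow_mul, ← pow_add] at h1 h2
    rw [add_comm t s] at h2
    exact (h1.trans (isConj_pow hc _)).trans h2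

/-- The set of all `p`-equivalence classes of partitions of `r`. -/
abbrev PClass (p r : ℕ) : Type :=
  Quotient (⟨PEquiv p, pEquiv_equivalence p r⟩ : Setoid r.Partition)

/-- The `p`-equivalence class of a partition; `lam` belongs to `J` iff `PClass.mk p lam = J`. -/
def PClass.mk (p : ℕ) {r : ℕ} (lam : r.Partition) : PClass p r :=
  Quotient.mk _ lam

/-! ### The descent algebra -/

/-- The symmetric group on `r` letters, with permutations multiplied from left to right. -/
abbrev Sym (r : ℕ) : Type := (Equiv.Perm (Fin r))ᵐᵒᵖ

/-- `σ` is increasing on each block of consecutive positions cut out by the composition `ν`, i.e.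
every descent of `σ` is at a partial sum of `ν`. -/
def IncreasingOnBlocks {r : ℕ} (ν : Composition r) (σ : Equiv.Perm (Fin r)) : Prop :=
  ∀ i j : Fin r, i < j → ν.index i = ν.index j → σ i < σ j

open Classical in
/-- The element `X^ν` of the group algebra `F Sym(r)`. -/
noncomputable def descentElt (F : Type*) [Field F] {r : ℕ} (ν : Composition r) :
    MonoidAlgebra F (Sym r) :=
  ∑ σ : Equiv.Perm (Fin r) with IncreasingOnBlocks ν σ,
    MonoidAlgebra.single (MulOpposite.op σ) (1 : F)

/-- The descent algebra `D_{r,F}`: the span of the elements `X^ν` in `F Sym(r)`. -/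
noncomputable def descentAlg (F : Type*) [Field F] (r : ℕ) :
    Submodule F (MonoidAlgebra F (Sym r)) :=
  Submodule.span F (Set.range (descentElt F (r := r)))

lemma mem_boundaries_iff {r : ℕ} (ν : Composition r) (j : Fin (r + 1)) :
    j ∈ ν.boundaries ↔ (j : ℕ) = 0 ∨ (j : ℕ) = r ∨
      ∃ (h0 : 0 < (j : ℕ)) (h1 : (j : ℕ) < r),
        ν.index ⟨(j : ℕ) - 1, by omega⟩ ≠ ν.index ⟨j, h1⟩ := by
  have key : j ∈ ν.boundaries ↔ ∃ k : ℕ, k ≤ ν.length ∧ ν.sizeUpTo k = j := by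
    simp only [Composition.boundaries, Finset.mem_map, Finset.mem_univ, true_and]
    constructor
    · rintro ⟨k, rfl⟩
      exact ⟨k, Nat.lt_succ_iff.1 k.2, rfl⟩
    · rintro ⟨k, hk, h⟩
      exact ⟨⟨k, Nat.lt_succ_iff.2 hk⟩, Fin.ext h⟩
  rw [key]
  constructor
  · rintro ⟨k, hk, h⟩
    by_cases h0 : (j : ℕ) = 0
    · exact Or.inl h0
    by_cases h1 : (j : ℕ) = r
    · exact Or.inr (Or.inl h1)
    refine Or.inr (Or.inr ⟨by omega, by omega, fun heq => ?_⟩)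
    have hjr : (j : ℕ) < r := by omega
    have a := ν.sizeUpTo_index_le ⟨(j : ℕ) - 1, by omega⟩
    have b := ν.lt_sizeUpTo_index_succ ⟨j, hjr⟩
    rw [heq] at a
    simp only [Fin.val_succ] at a b
    have c1 : (ν.index ⟨j, hjr⟩ : ℕ) < k := by
      by_contra hc
      have := ν.monotone_sizeUpTo (not_lt.1 hc)
      omega
    have c2 := ν.monotone_sizeUpTo (Nat.succ_le_of_lt c1)
    simp only [Nat.succ_eq_add_one] at c2
    omega
  · rintro (h | h | ⟨h0, h1, hne⟩)
    · exact ⟨0, Nat.zero_le _, by simp [h]⟩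
    · exact ⟨ν.length, le_rfl, by simp [h]⟩
    · refine ⟨ν.index ⟨j, h1⟩, (ν.index ⟨j, h1⟩).2.le, ?_⟩
      have a := ν.sizeUpTo_index_le ⟨j, h1⟩
      have a' := ν.sizeUpTo_index_le ⟨(j : ℕ) - 1, by omega⟩
      have b := ν.lt_sizeUpTo_index_succ ⟨(j : ℕ) - 1, by omega⟩
      have b' := ν.lt_sizeUpTo_index_succ ⟨j, h1⟩
      simp only [Fin.val_succ] at a a' b b'
      rcases lt_or_gt_of_ne (Fin.val_ne_of_ne hne) with hlt | hlt
      · have := ν.monotone_sizeUpTo (Nat.succ_le_of_lt hlt)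
        simp only [Nat.succ_eq_add_one] at this
        omega
      · have := ν.monotone_sizeUpTo (Nat.succ_le_of_lt hlt)
        simp only [Nat.succ_eq_add_one] at this
        omega

lemma index_mono {r : ℕ} (ν : Composition r) {i j : Fin r} (h : i ≤ j) :
    ν.index i ≤ ν.index j := by
  by_contra hc
  have h1 := ν.monotone_sizeUpTo (Nat.succ_le_of_lt (Fin.lt_def.1 (not_le.1 hc)))
  have a := ν.sizeUpTo_index_le i
  have b := ν.lt_sizeUpTo_index_succ j
  simp only [Fin.val_succ, Nat.succ_eq_add_one] at h1 b
  have := Fin.le_def.1 h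
  omega

lemma composition_eq_of_index {r : ℕ} {ν μ : Composition r}
    (h : ∀ i j, ν.index i = ν.index j ↔ μ.index i = μ.index j) : ν = μ := by
  apply (compositionEquiv r).injective
  refine CompositionAsSet.ext ?_
  change ν.boundaries = μ.boundaries
  ext j
  rw [mem_boundaries_iff, mem_boundaries_iff]
  simp only [ne_eq, h]

/-- There is a permutation whose descents are exactly at the partial sums of `ν`. -/
lemma exists_perm_descents {r : ℕ} (ν : Composition r) : ∃ σ : Equiv.Perm (Fin r),
    ∀ μ : Composition r, IncreasingOnBlocks μ σ ↔
      ∀ i j, μ.index i = μ.index j → ν.index i = ν.index j := by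
  let f : Fin r → (Fin ν.length)ᵒᵈ ×ₗ Fin r := fun i => toLex (OrderDual.toDual (ν.index i), i)
  have hf : Function.Injective f := fun i j h => (Prod.ext_iff.1 (toLex.injective h)).2
  have hs : StrictMono (f ∘ Tuple.sort f) :=
    (Tuple.monotone_sort f).strictMono_of_injective (hf.comp (Tuple.sort f).injective)
  have hlt : ∀ i j, (Tuple.sort f).symm i < (Tuple.sort f).symm j ↔ f i < f j := fun i j => by
    rw [← hs.lt_iff_lt]; simp
  have hlt' : ∀ i j, i < j → (f i < f j ↔ ν.index i = ν.index j) := fun i j hij => by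
    simp only [f, Prod.Lex.toLex_lt_toLex, OrderDual.toDual_lt_toDual, EmbeddingLike.apply_eq_iff_eq]
    have := index_mono ν hij.le
    constructor
    · rintro (h | h)
      · exact absurd h (not_lt.2 this)
      · exact h.1
    · exact fun h => Or.inr ⟨h, hij⟩
  refine ⟨(Tuple.sort f).symm, fun μ => ⟨fun h i j hij => ?_, fun h i j hij hi => ?_⟩⟩
  · rcases lt_trichotomy i j with hl | rfl | hl
    · exact (hlt' i j hl).1 ((hlt i j).1 (h i j hl hij))
    · rfl
    · exact ((hlt' j i hl).1 ((hlt j i).1 (h j i hl hij.symm))).symm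
  · exact (hlt i j).2 ((hlt' i j hij).2 (h i j hi))

open Classical in
lemma descentElt_apply (F : Type*) [Field F] {r : ℕ} (ν : Composition r)
    (σ : Equiv.Perm (Fin r)) :
    (descentElt F ν).coeff (MulOpposite.op σ) = if IncreasingOnBlocks ν σ then 1 else 0 := by
  simp [descentElt, MonoidAlgebra.coeff_single, Finsupp.single_apply]

lemma descentElt_linearIndependent (F : Type*) [Field F] (r : ℕ) :
    LinearIndependent F (descentElt F (r := r)) := by
  classical
  rw [Fintype.linearIndependent_iff]
  intro a ha
  let R : Composition r → Finset (Fin r × Fin r) :=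
    fun ν => Finset.univ.filter fun x => ν.index x.1 = ν.index x.2
  have hR : ∀ ν x, x ∈ R ν ↔ ν.index x.1 = ν.index x.2 := fun ν x => by simp [R]
  have main : ∀ n ν, (R ν).card = n → a ν = 0 := by
    intro n
    induction n using Nat.strong_induction_on with
    | _ n ih =>
      intro ν hn
      obtain ⟨σ, hσ⟩ := exists_perm_descents ν
      have h := congrArg (fun x : MonoidAlgebra F (Sym r) => x.coeff (MulOpposite.op σ)) ha
      simp only [MonoidAlgebra.coeff_sum, MonoidAlgebra.coeff_smul, Finsupp.coe_finsetSum,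
        Finset.sum_apply, Finsupp.smul_apply, descentElt_apply, MonoidAlgebra.coeff_zero,
        Finsupp.coe_zero, Pi.zero_apply, smul_eq_mul] at h
      rw [Finset.sum_eq_single ν] at h
      · rwa [if_pos ((hσ ν).2 fun _ _ hij => hij), mul_one] at h
      · intro μ _ hne
        by_cases hμ : IncreasingOnBlocks μ σ
        · rw [hσ] at hμ
          have hsub : R μ ⊂ R ν := by
            refine Finset.ssubset_iff_subset_ne.2
              ⟨fun x hx => (hR _ _).2 (hμ _ _ ((hR _ _).1 hx)), fun heq => hne ?_⟩
            refine composition_eq_of_index fun i j => ?_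
            rw [← hR μ (i, j), ← hR ν (i, j), heq]
          rw [ih _ (hn ▸ Finset.card_lt_card hsub) μ rfl, zero_mul]
        · rw [if_neg hμ, mul_zero]
      · exact fun hc => absurd (Finset.mem_univ ν) hc
  exact fun ν => main _ ν rfl

/-- The basis of the descent algebra formed by the elements `X^ν`. -/
noncomputable def descentBasis (F : Type*) [Field F] (r : ℕ) :
    Module.Basis (Composition r) F (descentAlg F r) :=
  Module.Basis.span (descentElt_linearIndependent F r)

/-- The Young subgroup `Sym(ν₁) × ⋯ × Sym(νₖ)` of `Sym(r)`: the permutations that map each block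
of `ν` to itself. -/
def youngSubgroup {r : ℕ} (ν : Composition r) : Subgroup (Equiv.Perm (Fin r)) where
  carrier := {σ | ∀ i, ν.index (σ i) = ν.index i}
  one_mem' := fun _ => rfl
  mul_mem' := fun {σ τ} hσ hτ i => (hσ (τ i)).trans (hτ i)
  inv_mem' := fun {σ} hσ i => by
    simpa using (hσ (σ⁻¹ i)).symm

/-- The Young character `φ^ν` of `Sym(r)`, induced from the trivial character of the Young
subgroup, i.e. the character of the permutation module on its cosets: `φ^ν(σ)` is the number of
cosets fixed by `σ`. -/
noncomputable def youngChar {r : ℕ} (ν : Composition r) (σ : Equiv.Perm (Fin r)) : ℕ :=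
  Nat.card (MulAction.fixedBy (Equiv.Perm (Fin r) ⧸ youngSubgroup ν) σ)

/-- The map `c_{r,F}` from the descent algebra to the functions `Sym(r) → F`: the linear map with
`c_{r,F}(X^ν) = φ^ν · 1_F` for all compositions `ν` of `r`. -/
noncomputable def charMap (F : Type*) [Field F] (r : ℕ) :
    descentAlg F r →ₗ[F] (Equiv.Perm (Fin r) → F) :=
  (descentBasis F r).constr F fun ν σ => (youngChar ν σ : F)

/-- `e` is a primitive idempotent of the descent algebra: a non-zero idempotent that is not the
sum of two non-zero orthogonal idempotents of the descent algebra. -/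
def IsPrimitiveIdempotent {F : Type*} [Field F] {r : ℕ} (e : MonoidAlgebra F (Sym r)) : Prop :=
  e ∈ descentAlg F r ∧ e * e = e ∧ e ≠ 0 ∧
    ∀ f ∈ descentAlg F r, ∀ g ∈ descentAlg F r,
      f * f = f → g * g = g → f * g = 0 → g * f = 0 → f + g = e → f = 0 ∨ g = 0

open Classical in
/-- `e` is a decomposition of `1` into pairwise orthogonal primitive idempotents `e_J` of the
descent algebra, indexed by the `p`-equivalence classes `J` of partitions of `r`, such that
`c_{r,F}(e_J)` takes the value `1` at the conjugacy classes indexed by the partitions in `J`, and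
the value `0` at all the others. -/
structure IsDescentIdempotents {F : Type*} [Field F] {p r : ℕ}
    (e : PClass p r → descentAlg F r) : Prop where
  primitive : ∀ J, IsPrimitiveIdempotent (e J : MonoidAlgebra F (Sym r))
  orthogonal : ∀ J K, J ≠ K → (e J : MonoidAlgebra F (Sym r)) * e K = 0
  sum_eq_one : ∑ J, (e J : MonoidAlgebra F (Sym r)) = 1
  charMap_eq : ∀ J σ, charMap F r (e J) σ = if PClass.mk p (cyclePartition σ) = J then 1 else 0

/-! ### Tensor powers, Lie powers and the filtration -/

section Tensor

attribute [local instance] LieRing.ofAssociativeRing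

variable (F : Type*) [Field F] (V : Type*) [AddCommGroup V] [Module F V] (r : ℕ)

/-- The left action of `Sym(r)` on `T^r(V)` by place permutations:
`σ (v₁ v₂ ⋯ vᵣ) = v_{1σ} v_{2σ} ⋯ v_{rσ}`. -/
noncomputable def placePerm : Sym r →* Module.End F (⨂[F]^r V) where
  toFun σ := (PiTensorProduct.reindex F (fun _ => V) σ.unop.symm).toLinearMap
  map_one' := by
    ext v
    simp only [LinearMap.compMultilinearMap_apply, LinearEquiv.coe_coe]
    rw [PiTensorProduct.reindex_tprod]
    rfl
  map_mul' σ τ := by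
    ext v
    simp only [LinearMap.compMultilinearMap_apply, LinearEquiv.coe_coe, Module.End.mul_apply]
    rw [PiTensorProduct.reindex_tprod, PiTensorProduct.reindex_tprod,
      PiTensorProduct.reindex_tprod]
    rfl

/-- The action of the group algebra `F Sym(r)` on `T^r(V)`. -/
noncomputable def tensorAction : MonoidAlgebra F (Sym r) →ₐ[F] Module.End F (⨂[F]^r V) :=
  MonoidAlgebra.lift F (Module.End F (⨂[F]^r V)) (Sym r) (placePerm F V r)

/-- The Lie power `L^i(V)`: the component in degree `i` of the Lie subalgebra `L(V)` of the tensor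
algebra `T(V)` generated by `V`. -/
noncomputable def liePower (i : ℕ) : Submodule F (TensorAlgebra F V) :=
  LinearMap.range (TensorAlgebra.ι F : V →ₗ[F] TensorAlgebra F V) ^ i ⊓
    (LieSubalgebra.lieSpan F (TensorAlgebra F V)
      (Set.range (TensorAlgebra.ι F : V →ₗ[F] TensorAlgebra F V))).toSubmodule

variable {r}

/-- The set `X_lam` of all the elements of `T^r(V)` that are, in `T(V)`, products `b₁ b₂ ⋯ bₗ` with
`bᵢ ∈ L^{μᵢ}(V)`, where `μ` is a composition of `r` with associated partition `lam`. -/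
def lieProducts (lam : r.Partition) : Set (⨂[F]^r V) :=
  {w | ∃ (μ : Composition r) (b : Fin μ.length → TensorAlgebra F V),
    Nat.Partition.ofComposition r μ = lam ∧ (∀ i, b i ∈ liePower F V (μ.blocksFun i)) ∧
      TensorPower.toTensorAlgebra w = (List.ofFn b).prod}

/-- The term `W_lam` of the PBW-filtration of `T^r(V)`. -/
def pbwW (lam : r.Partition) : Submodule F (⨂[F]^r V) :=
  Submodule.span F {w | ∃ theta, LexLE lam theta ∧ w ∈ lieProducts F V theta}

/-- The next term `W_{lam+}` of the PBW-filtration of `T^r(V)`; it is `W` of the partition next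
bigger than `lam`, and `0` for the largest partition `lam = (r)`. -/
def pbwWPlus (lam : r.Partition) : Submodule F (⨂[F]^r V) :=
  Submodule.span F {w | ∃ theta, LexLT lam theta ∧ w ∈ lieProducts F V theta}

variable {F V}

/-- `Y` is a subset of `W_lam` such that the cosets `y + W_{lam+}`, for `y` in `Y`, are distinct
and form a basis of `W_lam / W_{lam+}`. -/
structure IsLiftedBasis (lam : r.Partition) (Y : Set (⨂[F]^r V)) : Prop where
  subset : Y ⊆ pbwW F V lam
  linearIndependent : LinearIndependent F fun y : Y =>
    ((pbwWPlus F V lam).submoduleOf (pbwW F V lam)).mkQ ⟨y, subset y.2⟩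
  span_eq_top : Submodule.span F (Set.range fun y : Y =>
    ((pbwWPlus F V lam).submoduleOf (pbwW F V lam)).mkQ ⟨y, subset y.2⟩) = ⊤

/-- The union of the sets `Y lam` over the partitions `lam` in the class `J`. -/
def classUnion {p : ℕ} (Y : r.Partition → Set (⨂[F]^r V)) (J : PClass p r) :
    Set (⨂[F]^r V) :=
  ⋃ lam, ⋃ _ : PClass.mk p lam = J, Y lam

end Tensor

end DescentPBW

namespace DescentPBW

/-! The heart of the matter is that an element `d` of the descent algebra maps `W_λ` to itself and
acts on `W_λ / W_{λ+}` as the scalar `c(d)(λ)` (`descentAlg_sub_mem`). By linearity it is enough to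
treat `X^ν`.

On `T^r(V)`, `X^ν` is the coproduct of `T(V)` into `k` factors, followed by projection to
multidegree `ν` and multiplication (`toTensorAlgebra_descentElt`). Lie elements are primitive for
this coproduct. Hence `X^ν` sends a product `b_1 ⋯ b_l` of Lie elements to a sum over the
distributions of the factors among the `k` slots with total degree `ν_j` in slot `j`; each summand
is a reordering of `b_1 ⋯ b_l`. Swapping adjacent factors costs a commutator, which merges two parts
of the partition and so lies in `W_{λ+}` (`prod_sub_prod_mem_of_perm`). Modulo `W_{λ+}` the sum is
therefore the number of distributions times the original product, and that number is `φ^ν(λ)`, the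
number of ways to colour the cycles of a permutation of type `λ` with content `ν`
(`youngChar_eq_card_fillings`).

Consequently `e_J` acts on `W_λ / W_{λ+}` as the identity for `λ ∈ J` and as zero otherwise.
Triangularity with respect to the lexicographic order then gives the independence of the `e_J y`
(`linearIndepOn_classUnion`), and descending induction together with `e_J e_J = e_J` shows that they
span `e_J T^r(V)` (`span_image_classUnion`). -/

/-! ### Young characters as numbers of fillings. -/

lemma exists_equiv_of_card_fiber_eq {α β γ : Type*} [Fintype α] [Fintype β] [DecidableEq γ]
    {f : α → γ} {g : β → γ} (h : ∀ c, Fintype.card {a // f a = c} = Fintype.card {b // g b = c}) :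
    ∃ e : α ≃ β, ∀ a, g (e a) = f a :=
  ⟨Equiv.ofFiberEquiv fun c => Fintype.equivOfCardEq (h c), fun a => Equiv.ofFiberEquiv_map _ a⟩

lemma exists_equiv_of_map_univ_eq {α β γ : Type*} [Fintype α] [Fintype β] [DecidableEq γ]
    {f : α → γ} {g : β → γ} (h : Finset.univ.val.map f = Finset.univ.val.map g) :
    ∃ e : α ≃ β, ∀ a, g (e a) = f a := by
  refine exists_equiv_of_card_fiber_eq fun c => ?_
  have := congrArg (Multiset.count c) h
  simp only [Multiset.count_map, eq_comm (a := c)] at this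
  rw [Fintype.card_subtype, Fintype.card_subtype]
  exact this

/-- `g` assigns exactly `ν_j` points to the `j`-th block of `ν`, for every `j`. -/
def HasContent {r : ℕ} (ν : Composition r) (g : Fin r → Fin ν.length) : Prop :=
  ∀ j, (Finset.univ.filter fun x => g x = j).card = ν.blocksFun j

lemma hasContent_index {r : ℕ} (ν : Composition r) : HasContent ν ν.index := by
  intro j
  rw [← Fintype.card_subtype, ← Fintype.card_fin (ν.blocksFun j)]
  refine Fintype.card_congr ((ν.blocksFinEquiv.symm.subtypeEquiv (q := fun y => y.1 = j)
    fun a => Iff.rfl).trans (Equiv.sigmaSubtype j))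

lemma HasContent.comp_perm {r : ℕ} {ν : Composition r} {g : Fin r → Fin ν.length}
    (h : HasContent ν g) (σ : Equiv.Perm (Fin r)) : HasContent ν (g ∘ σ) := by
  intro j
  rw [← h j, ← Fintype.card_subtype, ← Fintype.card_subtype]
  exact Fintype.card_congr (σ.subtypeEquiv fun a => Iff.rfl)

lemma HasContent.exists_perm {r : ℕ} {ν : Composition r} {g : Fin r → Fin ν.length}
    (h : HasContent ν g) : ∃ σ : Equiv.Perm (Fin r), ∀ x, g (σ x) = ν.index x := by
  refine exists_equiv_of_card_fiber_eq fun j => ?_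
  rw [Fintype.card_subtype, Fintype.card_subtype, h j, hasContent_index ν j]

/-- `Sym(r)` acts transitively on the colourings of content `ν`, and the Young subgroup is the
stabilizer of `ν.index`. The coset of `a` thus corresponds to the colouring `ν.index ∘ a⁻¹`, and
fixed cosets to invariant colourings. -/
lemma youngChar_eq_card {r : ℕ} (ν : Composition r) (σ : Equiv.Perm (Fin r)) :
    youngChar ν σ = Nat.card {g : Fin r → Fin ν.length // HasContent ν g ∧ ∀ x, g (σ x) = g x} := by
  unfold youngChar
  let f : Equiv.Perm (Fin r) ⧸ youngSubgroup ν → (Fin r → Fin ν.length) :=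
    Quotient.lift (fun a : Equiv.Perm (Fin r) => ν.index ∘ ⇑a⁻¹) (by
      intro a b hab
      have h : a⁻¹ * b ∈ youngSubgroup ν := QuotientGroup.leftRel_apply.1 hab
      funext x
      have := h (b⁻¹ x)
      simpa using this)
  have hf : ∀ a : Equiv.Perm (Fin r), f (a : Equiv.Perm (Fin r) ⧸ youngSubgroup ν)
      = ν.index ∘ ⇑a⁻¹ := fun a => rfl
  have hinj : Function.Injective f := by
    intro x y
    induction x using QuotientGroup.induction_on with | _ a
    induction y using QuotientGroup.induction_on with | _ b
    intro h
    rw [hf, hf] at h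
    refine QuotientGroup.eq.2 fun i => ?_
    have := congrFun h (b i)
    simpa using this
  have hfix : ∀ x, σ • x = x ↔ ∀ i, f x (σ i) = f x i := by
    intro x
    induction x using QuotientGroup.induction_on with | _ a
    have : σ • (a : Equiv.Perm (Fin r) ⧸ youngSubgroup ν) = ((σ * a : Equiv.Perm (Fin r)) : _) := rfl
    rw [← hinj.eq_iff, this, hf, hf]
    constructor
    · intro h i
      have := congrFun h (σ i)
      simpa using this.symm
    · intro h
      funext i
      have := h (σ⁻¹ i)
      simpa using this.symm
  refine Nat.card_congr (Equiv.ofBijective (fun x => ⟨f x.1, ?_, (hfix _).1 x.2⟩) ⟨?_, ?_⟩)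
  · obtain ⟨x, hx⟩ := x
    induction x using QuotientGroup.induction_on with | _ a
    exact (hasContent_index ν).comp_perm _
  · exact fun x y h => Subtype.ext (hinj (Subtype.ext_iff.1 h))
  · rintro ⟨g, hg, hgσ⟩
    obtain ⟨a, ha⟩ := hg.exists_perm
    have hga : f (a : Equiv.Perm (Fin r) ⧸ youngSubgroup ν) = g := by
      rw [hf]
      funext x
      have := ha (a⁻¹ x)
      simpa using this.symm
    exact ⟨⟨a, (hfix _).2 (hga ▸ hgσ)⟩, Subtype.ext hga⟩

/-- The points fixed by a permutation and its cycles of length at least `2`. -/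
abbrev CycleIndex {r : ℕ} (σ : Equiv.Perm (Fin r)) : Type :=
  {c // c ∈ σ.cycleFactorsFinset} ⊕ {x // σ x = x}

/-- The length of a cycle. -/
def cycleSize {r : ℕ} (σ : Equiv.Perm (Fin r)) : CycleIndex σ → ℕ :=
  Sum.elim (fun c => c.1.support.card) fun _ => 1

lemma map_cycleSize {r : ℕ} (σ : Equiv.Perm (Fin r)) :
    Finset.univ.val.map (cycleSize σ) = (cyclePartition σ).parts := by
  change _ = σ.partition.parts
  rw [Equiv.Perm.parts_partition, Equiv.Perm.cycleType_def]
  have hu : (Finset.univ : Finset (CycleIndex σ)).val =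
      (Finset.univ : Finset {c // c ∈ σ.cycleFactorsFinset}).val.map Sum.inl +
      (Finset.univ : Finset {x // σ x = x}).val.map Sum.inr := rfl
  rw [hu, Multiset.map_add, Multiset.map_map, Multiset.map_map]
  congr 1
  · change Multiset.map (fun c : {c // c ∈ σ.cycleFactorsFinset} => c.1.support.card) _ = _
    have : (Finset.univ : Finset {c // c ∈ σ.cycleFactorsFinset}).val
      = σ.cycleFactorsFinset.val.attach := rfl
    rw [this]
    exact Multiset.attach_map_val' _ (fun c : Equiv.Perm (Fin r) => c.support.card)
  · change Multiset.map (fun _ => 1) _ = _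
    rw [Multiset.map_const']
    congr 1
    change Fintype.card {x // σ x = x} = _
    rw [← Finset.card_compl, Fintype.card_subtype]
    congr 1
    ext x
    simp

/-- The cycle that contains a point. -/
def toCycle {r : ℕ} (σ : Equiv.Perm (Fin r)) (x : Fin r) : CycleIndex σ :=
  if h : σ x = x then Sum.inr ⟨x, h⟩ else
    Sum.inl ⟨σ.cycleOf x, Equiv.Perm.cycleOf_mem_cycleFactorsFinset_iff.2
      (Equiv.Perm.mem_support.2 h)⟩

lemma card_toCycle {r : ℕ} (σ : Equiv.Perm (Fin r)) (c : CycleIndex σ) :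
    (Finset.univ.filter fun x => toCycle σ x = c).card = cycleSize σ c := by
  rcases c with ⟨c, hc⟩ | ⟨y, hy⟩
  · change _ = c.support.card
    congr 1
    ext x
    rw [Finset.mem_filter, toCycle]
    constructor
    · rintro ⟨-, h⟩
      split_ifs at h with h1
      have := (Sum.inl.inj h)
      rw [Subtype.mk.injEq] at this
      rw [← this]
      simpa using h1
    · intro hx
      have h1 : σ x ≠ x := by
        have := Equiv.Perm.mem_cycleFactorsFinset_support_le hc hx
        simpa using this
      refine ⟨Finset.mem_univ _, ?_⟩
      rw [dif_neg h1]
      congr 2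
      exact (Equiv.Perm.cycle_is_cycleOf hx hc).symm
  · change _ = 1
    rw [Finset.card_eq_one]
    refine ⟨y, ?_⟩
    ext x
    rw [Finset.mem_filter, toCycle, Finset.mem_singleton]
    constructor
    · rintro ⟨-, h⟩
      split_ifs at h with h1
      simpa using h
    · rintro rfl
      simp [hy]

lemma toCycle_surjective {r : ℕ} (σ : Equiv.Perm (Fin r)) : Function.Surjective (toCycle σ) := by
  intro c
  have : 0 < cycleSize σ c := by
    rcases c with ⟨c, hc⟩ | y
    · exact Finset.card_pos.2 (Equiv.Perm.mem_cycleFactorsFinset_iff.1 hc).1.nonempty_support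
    · exact one_pos
  rw [← card_toCycle] at this
  obtain ⟨x, hx⟩ := Finset.card_pos.1 this
  exact ⟨x, (Finset.mem_filter.1 hx).2⟩

lemma toCycle_apply {r : ℕ} (σ : Equiv.Perm (Fin r)) (x : Fin r) :
    toCycle σ (σ x) = toCycle σ x := by
  unfold toCycle
  by_cases h : σ x = x
  · simp [h]
  · rw [dif_neg h, dif_neg (fun h' => h (σ.injective h'))]
    congr 2
    simp

lemma sameCycle_of_toCycle_eq {r : ℕ} {σ : Equiv.Perm (Fin r)} {x y : Fin r}
    (h : toCycle σ x = toCycle σ y) : σ.SameCycle x y := by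
  unfold toCycle at h
  split_ifs at h with h1 h2
  · have h := Sum.inr.inj h
    rw [Subtype.mk.injEq] at h
    rw [h]
  · have h := Sum.inl.inj h
    rw [Subtype.mk.injEq] at h
    rwa [Equiv.Perm.sameCycle_iff_cycleOf_eq_of_mem_support] <;> simpa

lemma apply_eq_of_sameCycle {α β : Type*} {σ : Equiv.Perm α} {g : α → β}
    (hg : ∀ x, g (σ x) = g x) {x y : α} (h : σ.SameCycle x y) : g x = g y := by
  obtain ⟨n, rfl⟩ := h
  induction n using Int.induction_on with
  | zero => rfl
  | succ n ih => rw [add_comm, zpow_add, zpow_one, Equiv.Perm.mul_apply, hg, ih]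
  | pred n ih => rw [ih, ← hg ((σ ^ (-(n : ℤ) - 1)) x), ← Equiv.Perm.mul_apply, ← zpow_one_add]; ring_nf

/-- `f` distributes objects of sizes `d i` to the blocks of `ν` so that every block gets
objects of total size `ν_j`. -/
def IsFilling {r : ℕ} (ν : Composition r) {ι : Type*} [Fintype ι] (d : ι → ℕ)
    (f : ι → Fin ν.length) : Prop :=
  ∀ j, ∑ i with f i = j, d i = ν.blocksFun j

lemma isFilling_one {r : ℕ} (ν : Composition r) (f : Fin r → Fin ν.length) :
    IsFilling ν (fun _ => 1) f ↔ HasContent ν f := by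
  simp [IsFilling, HasContent]

lemma isFilling_cycle {r : ℕ} (ν : Composition r) (σ : Equiv.Perm (Fin r))
    (f : CycleIndex σ → Fin ν.length) :
    IsFilling ν (cycleSize σ) f ↔ HasContent ν (f ∘ toCycle σ) := by
  refine forall_congr' fun j => ?_
  rw [Finset.card_eq_sum_card_fiberwise (f := toCycle σ) (t := Finset.univ.filter fun c => f c = j)
    (fun x hx => by simpa using hx)]
  suffices h : ∀ c ∈ Finset.univ.filter fun c => f c = j, cycleSize σ c =
      ((Finset.univ.filter fun x => (f ∘ toCycle σ) x = j).filter fun x => toCycle σ x = c).card by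
    rw [Finset.sum_congr rfl h]
  intro c hc
  rw [← card_toCycle, Finset.filter_filter]
  congr 1
  ext x
  simp only [Finset.mem_filter, Finset.mem_univ, true_and, Function.comp] at hc ⊢
  constructor
  · rintro rfl; exact ⟨hc, rfl⟩
  · exact fun h => h.2

/-- An invariant colouring is constant on cycles, so it amounts to a colouring of the cycles
weighted by length. Only the multiset of lengths matters, so `d` may list them in any order; later
it is the list of degrees of the Lie factors. -/
lemma youngChar_eq_card_fillings {r : ℕ} (ν : Composition r) (σ : Equiv.Perm (Fin r))
    {l : ℕ} (d : Fin l → ℕ) (h : Finset.univ.val.map d = (cyclePartition σ).parts) :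
    youngChar ν σ = Nat.card {f : Fin l → Fin ν.length // IsFilling ν d f} := by
  rw [youngChar_eq_card]
  obtain ⟨e, he⟩ := exists_equiv_of_map_univ_eq (h.trans (map_cycleSize σ).symm)
  have h1 : Nat.card {f : Fin l → Fin ν.length // IsFilling ν d f} =
      Nat.card {f : CycleIndex σ → Fin ν.length // IsFilling ν (cycleSize σ) f} := by
    refine Nat.card_congr ((e.arrowCongr (Equiv.refl _)).subtypeEquiv fun f => ?_)
    refine forall_congr' fun j => ?_
    suffices ∑ i with f i = j, d i = ∑ i with (e.arrowCongr (Equiv.refl _)) f i = j, cycleSize σ i by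
      rw [this]
    refine Finset.sum_equiv e (fun i => by simp) fun i _ => (he i).symm
  rw [h1]
  symm
  refine Nat.card_congr (Equiv.ofBijective (fun f => ⟨f.1 ∘ toCycle σ,
    (isFilling_cycle ν σ f.1).1 f.2, fun x => by simp [toCycle_apply]⟩) ⟨?_, ?_⟩)
  · intro f g hfg
    exact Subtype.ext ((toCycle_surjective σ).injective_comp_right (Subtype.ext_iff.1 hfg))
  · rintro ⟨g, hg, hgσ⟩
    choose s hs using toCycle_surjective σ
    have : (g ∘ s) ∘ toCycle σ = g := by
      funext x
      exact apply_eq_of_sameCycle hgσ (sameCycle_of_toCycle_eq (hs _))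
    exact ⟨⟨g ∘ s, (isFilling_cycle ν σ _).2 (by rwa [this])⟩, Subtype.ext this⟩

/-! ### The lexicographic order on partitions. -/

lemma le_getD_iff {m : ℕ} (hm : 0 < m) {L : List ℕ} (hL : L.Pairwise (· ≥ ·)) (i : ℕ) :
    m ≤ L.getD i 0 ↔ i < L.countP (m ≤ ·) := by
  induction L generalizing i with
  | nil => simp; omega
  | cons a L ih =>
    rw [List.pairwise_cons] at hL
    rw [List.countP_cons]
    by_cases ha : m ≤ a
    · cases i with
      | zero => simp [ha]
      | succ i => simp [ha, ← ih hL.2]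
    · have h0 : L.countP (m ≤ ·) = 0 := by
        rw [List.countP_eq_zero]
        intro b hb
        have := hL.1 b hb
        simp; omega
      rw [h0]
      cases i with
      | zero => simp [ha]
      | succ i =>
        have := ih hL.2 i
        rw [h0] at this
        simp only [List.getD_cons_succ, this]
        simp [ha]

/-- This is conjugation of partitions. It replaces the sorted list by counts on the multiset of
parts, which are easy to track when parts are merged. Positivity of `m` makes the default value `0`
beyond the last part harmless. -/
lemma le_part_iff {r m : ℕ} (hm : 0 < m) (lam : r.Partition) (i : ℕ) :
    m ≤ part lam i ↔ i < lam.parts.countP (m ≤ ·) := by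
  have hs := lam.parts.pairwise_sort (· ≥ ·)
  rw [part, le_getD_iff hm hs, ← Multiset.coe_countP, Multiset.sort_eq]

lemma part_injective {r : ℕ} : Function.Injective (part (r := r)) := by
  intro lam theta h
  refine Nat.Partition.ext ?_
  have hc : ∀ m, 0 < m → lam.parts.countP (m ≤ ·) = theta.parts.countP (m ≤ ·) := by
    intro m hm
    refine eq_of_forall_lt_iff fun i => ?_
    rw [← le_part_iff hm, ← le_part_iff hm, h]
  -- Multiplicities are differences of consecutive counts, so the counts determine the multiset.
  have hd : ∀ (s : Multiset ℕ) m, s.countP (m ≤ ·) = s.count m + s.countP (m + 1 ≤ ·) := by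
    intro s m
    induction s using Multiset.induction with
    | empty => simp
    | cons a s ih =>
      rw [Multiset.countP_cons, Multiset.countP_cons, Multiset.count_cons, ih]
      split_ifs <;> omega
  ext m
  rcases Nat.eq_zero_or_pos m with rfl | hm
  · rw [Multiset.count_eq_zero_of_notMem, Multiset.count_eq_zero_of_notMem]
    · exact fun h0 => (theta.parts_pos h0).false
    · exact fun h0 => (lam.parts_pos h0).false
  · have h1 := hd lam.parts m
    have h2 := hd theta.parts m
    have := hc m hm
    have := hc (m + 1) (by omega)
    omega

/-- The lexicographic order on the partitions of `r` as a linear order. -/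
noncomputable abbrev partitionLinearOrder (r : ℕ) : LinearOrder r.Partition :=
  LinearOrder.lift' (fun lam => (toLex (part lam) : Lex (ℕ → ℕ)))
    (toLex.injective.comp part_injective)

lemma partitionLinearOrder_lt_iff {r : ℕ} {lam theta : r.Partition} :
    (partitionLinearOrder r).lt lam theta ↔ LexLT lam theta := by
  change Pi.Lex _ _ _ _ ↔ _
  exact exists_congr fun i => and_comm

lemma LexLT.trans {r : ℕ} {lam theta eta : r.Partition} (h : LexLT lam theta)
    (h' : LexLT theta eta) : LexLT lam eta := by
  let := partitionLinearOrder r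
  rw [← partitionLinearOrder_lt_iff] at *
  exact lt_trans h h'

lemma LexLT.trans_le {r : ℕ} {lam theta eta : r.Partition} (h : LexLT lam theta)
    (h' : LexLE theta eta) : LexLT lam eta := by
  rcases h' with rfl | h'
  · exact h
  · exact h.trans h'

/-- Descending induction along the lexicographic order. -/
lemma lex_induction {r : ℕ} {P : r.Partition → Prop}
    (h : ∀ lam, (∀ theta, LexLT lam theta → P theta) → P lam) (lam : r.Partition) : P lam := by
  let := partitionLinearOrder r
  induction lam using (Finite.wellFounded_of_trans_of_irrefl
    (fun a b : r.Partition => b < a)).induction with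
  | _ lam ih => exact h lam fun theta ht => ih theta (partitionLinearOrder_lt_iff.2 ht)

lemma exists_lex_min {r : ℕ} (s : Finset r.Partition) (hs : s.Nonempty) :
    ∃ lam ∈ s, ∀ theta ∈ s, theta ≠ lam → LexLT lam theta := by
  let := partitionLinearOrder r
  refine ⟨s.min' hs, s.min'_mem hs, fun theta ht hne => ?_⟩
  exact partitionLinearOrder_lt_iff.1 (lt_of_le_of_ne (s.min'_le _ ht) hne.symm)

/-- Merging two parts of a partition makes it lexicographically larger. -/
lemma lexLT_of_merge {r a b : ℕ} (ha : 0 < a) (hb : 0 < b) {s : Multiset ℕ}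
    {lam theta : r.Partition} (hl : lam.parts = a ::ₘ b ::ₘ s)
    (ht : theta.parts = (a + b) ::ₘ s) : LexLT lam theta := by
  have hl' : ∀ m, lam.parts.countP (m ≤ ·) =
      s.countP (m ≤ ·) + (if m ≤ b then 1 else 0) + (if m ≤ a then 1 else 0) := fun m => by
    rw [hl, Multiset.countP_cons, Multiset.countP_cons]
  have ht' : ∀ m, theta.parts.countP (m ≤ ·) =
      s.countP (m ≤ ·) + (if m ≤ a + b then 1 else 0) := fun m => by
    rw [ht, Multiset.countP_cons]
  have hab : 0 < a + b := by omega
  have hN := hl' (a + b)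
  have hN' := ht' (a + b)
  rw [if_neg (by omega), if_neg (by omega)] at hN
  rw [if_pos le_rfl] at hN'
  -- The parts of `s` that are at least `a + b` come first in both partitions. At the next index
  -- `theta` still has a part at least `a + b`, whereas `lam` does not.
  refine ⟨s.countP (a + b ≤ ·), ?_, fun j hj => ?_⟩
  · have h1 := le_part_iff hab theta (s.countP (a + b ≤ ·))
    have h2 := le_part_iff hab lam (s.countP (a + b ≤ ·))
    rw [hN] at h2
    rw [hN'] at h1
    omega
  · refine eq_of_forall_le_iff fun m => ?_
    rcases Nat.eq_zero_or_pos m with rfl | hm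
    · simp
    rw [le_part_iff hm, le_part_iff hm, hl', ht']
    by_cases h : m ≤ a + b
    · have : s.countP (a + b ≤ ·) ≤ s.countP (m ≤ ·) := by
        rw [Multiset.countP_eq_card_filter, Multiset.countP_eq_card_filter]
        refine Multiset.card_le_card (Multiset.monotone_filter_right _ fun x _ => ?_)
        omega
      constructor <;> intro _ <;> omega
    · rw [if_neg (by omega), if_neg (by omega), if_neg h]

/-! ### Products regrouped by slots. -/

section Rearrange

/-- The list of all `i : Fin l`, sorted by the value of `f` first and by `i` second. -/
def blockList {l k : ℕ} (f : Fin l → Fin k) : List (Fin l) :=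
  (List.finRange k).flatMap fun j => (List.finRange l).filter fun i => f i = j

lemma pairwise_blockList {l k : ℕ} (f : Fin l → Fin k) :
    (blockList f).Pairwise fun x y => toLex (f x, x) < toLex (f y, y) := by
  refine List.pairwise_flatMap.2 ⟨fun j _ => ?_, ?_⟩
  · refine ((List.pairwise_lt_finRange l).filter _).imp_of_mem fun {x y} hx hy h => ?_
    simp only [List.mem_filter, decide_eq_true_eq] at hx hy
    exact Prod.Lex.toLex_lt_toLex.2 (Or.inr ⟨hx.2.trans hy.2.symm, h⟩)
  · refine (List.pairwise_lt_finRange k).imp fun {a b} h x hx y hy => ?_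
    simp only [List.mem_filter, decide_eq_true_eq] at hx hy
    exact Prod.Lex.toLex_lt_toLex.2 (Or.inl (by simpa [hx.2, hy.2] using h))

lemma blockList_perm {l k : ℕ} (f : Fin l → Fin k) :
    (blockList f).Perm (List.finRange l) := by
  refine (List.perm_ext_iff_of_nodup ?_ (List.nodup_finRange l)).2 fun i => ?_
  · exact (pairwise_blockList f).imp fun {x y} h hxy => by simp [hxy] at h
  · simp [blockList]

/-- Both lists enumerate `Fin l` in strictly increasing order of `(f x, x)`: `Tuple.sort` is a
stable sort. -/
lemma blockList_eq_ofFn_sort {l k : ℕ} (f : Fin l → Fin k) :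
    blockList f = List.ofFn (Tuple.sort f) := by
  have hanti : Std.Antisymm fun x y : Fin l => toLex (f x, x) < toLex (f y, y) :=
    ⟨fun x y h h' => absurd h h'.asymm⟩
  refine List.Perm.eq_of_pairwise' (pairwise_blockList f) ?_ ((blockList_perm f).trans ?_)
  · obtain ⟨hm, hs⟩ := Tuple.eq_sort_iff.1 (rfl : Tuple.sort f = Tuple.sort f)
    rw [List.pairwise_ofFn]
    intro i j hij
    rw [Prod.Lex.toLex_lt_toLex]
    rcases (hm hij.le).lt_or_eq with h | h
    · exact Or.inl h
    · exact Or.inr ⟨h, hs i j hij h⟩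
  · exact (List.perm_ext_iff_of_nodup (List.nodup_finRange l)
      (List.nodup_ofFn.2 (Tuple.sort f).injective)).2 fun i => by
        simp [List.mem_ofFn, (Tuple.sort f).surjective i]

lemma prod_map_blockList {A : Type*} [Monoid A] {l k : ℕ} (f : Fin l → Fin k) (b : Fin l → A) :
    (List.ofFn fun j => (List.ofFn fun i => if f i = j then b i else 1).prod).prod =
      ((blockList f).map b).prod := by
  have h1 : ∀ (j : Fin k) (L : List (Fin l)), (L.map fun i => if f i = j then b i else 1).prod =
      ((L.filter fun i => f i = j).map b).prod := by
    intro j L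
    induction L with
    | nil => rfl
    | cons a L ih =>
      rw [List.map_cons, List.prod_cons, ih, List.filter_cons]
      by_cases h : f a = j <;> simp [h]
  have h2 : ∀ L : List (Fin k),
      (L.map fun j => (List.ofFn fun i => if f i = j then b i else 1).prod).prod =
      ((L.flatMap fun j => (List.finRange l).filter fun i => f i = j).map b).prod := by
    intro L
    induction L with
    | nil => rfl
    | cons a L ih =>
      rw [List.map_cons, List.prod_cons, ih, List.flatMap_cons, List.map_append, List.prod_append,
        List.ofFn_eq_map, h1]
  rw [List.ofFn_eq_map, h2, blockList]

end Rearrange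

/-! ### The coproduct of the tensor algebra and the action of `X^ν`. -/

section Coproduct

attribute [local instance] LieRing.ofAssociativeRing

variable (F : Type*) [Field F] (V : Type*) [AddCommGroup V] [Module F V]

/-- The algebra homomorphism `T(V) → T(V)^{⊗k}` for which the elements of `V` are primitive. -/
noncomputable def coproduct (k : ℕ) :
    TensorAlgebra F V →ₐ[F] ⨂[F] _ : Fin k, TensorAlgebra F V :=
  TensorAlgebra.lift F (∑ j : Fin k,
    (PiTensorProduct.singleAlgHom (A := fun _ => TensorAlgebra F V) j).toLinearMap ∘ₗ
      TensorAlgebra.ι F)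

variable {F V}

/-- Primitive elements form a Lie subalgebra: in the commutator of two primitive elements the mixed
terms cancel, since different tensor slots commute. This subalgebra contains `V`. -/
lemma coproduct_eq_of_mem_lieSpan {k : ℕ} {b : TensorAlgebra F V}
    (hb : b ∈ LieSubalgebra.lieSpan F (TensorAlgebra F V)
      (Set.range (TensorAlgebra.ι F : V →ₗ[F] TensorAlgebra F V))) :
    coproduct F V k b = ∑ j : Fin k,
      PiTensorProduct.singleAlgHom (R := F) (A := fun _ => TensorAlgebra F V) j b := by
  let P : TensorAlgebra F V →ₗ[F] ⨂[F] _ : Fin k, TensorAlgebra F V :=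
    ∑ j : Fin k, (PiTensorProduct.singleAlgHom (A := fun _ => TensorAlgebra F V) j).toLinearMap
  have hP : ∀ x, P x = ∑ j : Fin k,
      PiTensorProduct.singleAlgHom (R := F) (A := fun _ => TensorAlgebra F V) j x := fun x => by
    simp only [P, LinearMap.sum_apply, AlgHom.toLinearMap_apply]
  have hcomm : ∀ (i j : Fin k) (x y : TensorAlgebra F V), i ≠ j → Commute
      (PiTensorProduct.singleAlgHom (R := F) (A := fun _ => TensorAlgebra F V) i x)
      (PiTensorProduct.singleAlgHom (R := F) (A := fun _ => TensorAlgebra F V) j y) := by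
    intro i j x y hij
    rw [PiTensorProduct.singleAlgHom_apply, PiTensorProduct.singleAlgHom_apply]
    exact Commute.tprod (Pi.mulSingle_commute (f := fun _ : Fin k => TensorAlgebra F V) hij x y)
  have hPmul : ∀ x y, P x * P y - P y * P x = P (x * y - y * x) := by
    intro x y
    rw [hP, hP, hP, Finset.sum_mul_sum, Finset.sum_mul_sum, Finset.sum_comm, ← Finset.sum_sub_distrib]
    refine Finset.sum_congr rfl fun i _ => ?_
    rw [← Finset.sum_sub_distrib, Finset.sum_eq_single i]
    · rw [map_sub, map_mul, map_mul]
    · intro j _ hj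
      rw [(hcomm j i x y hj).eq, sub_self]
    · exact fun h => absurd (Finset.mem_univ i) h
  let S : LieSubalgebra F (TensorAlgebra F V) :=
    { LinearMap.eqLocus (coproduct F V k).toLinearMap P with
      lie_mem' := by
        intro x y hx hy
        change coproduct F V k x = P x at hx
        change coproduct F V k y = P y at hy
        change coproduct F V k (x * y - y * x) = P (x * y - y * x)
        rw [map_sub, map_mul, map_mul, hx, hy, hPmul] }
  have hS : LieSubalgebra.lieSpan F (TensorAlgebra F V)
      (Set.range (TensorAlgebra.ι F : V →ₗ[F] TensorAlgebra F V)) ≤ S := by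
    rw [LieSubalgebra.lieSpan_le]
    rintro _ ⟨v, rfl⟩
    change coproduct F V k (TensorAlgebra.ι F v) = P (TensorAlgebra.ι F v)
    rw [hP, coproduct, TensorAlgebra.lift_ι_apply]
    simp only [LinearMap.sum_apply, LinearMap.comp_apply, AlgHom.toLinearMap_apply]
  have := hS hb
  change coproduct F V k b = P b at this
  rw [this, hP]

/-- Expanding the product of the sums given by primitivity, `f` records the slot chosen for each
factor. Within a slot the factors keep their original order. -/
lemma coproduct_prod {k l : ℕ} {b : Fin l → TensorAlgebra F V}
    (hb : ∀ i, b i ∈ LieSubalgebra.lieSpan F (TensorAlgebra F V)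
      (Set.range (TensorAlgebra.ι F : V →ₗ[F] TensorAlgebra F V))) :
    coproduct F V k (List.ofFn b).prod = ∑ f : Fin l → Fin k,
      PiTensorProduct.tprod F fun j => (List.ofFn fun i => if f i = j then b i else 1).prod := by
  rw [map_list_prod, List.map_ofFn, ← MultilinearMap.mkPiAlgebraFin_apply (R := F)]
  have : ⇑(coproduct F V k) ∘ b = fun i => ∑ j : Fin k,
      PiTensorProduct.singleAlgHom (R := F) (A := fun _ => TensorAlgebra F V) j (b i) := by
    funext i
    exact coproduct_eq_of_mem_lieSpan (hb i)
  rw [this, MultilinearMap.map_sum]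
  refine Finset.sum_congr rfl fun f _ => ?_
  rw [MultilinearMap.mkPiAlgebraFin_apply]
  have h2 : (List.ofFn fun i => PiTensorProduct.singleAlgHom (R := F)
        (A := fun _ : Fin k => TensorAlgebra F V) (f i) (b i)) =
      (List.ofFn fun i => (Pi.mulSingle (f i) (b i) : Fin k → TensorAlgebra F V)).map
        (PiTensorProduct.tprodMonoidHom F) := by
    rw [List.map_ofFn]
    rfl
  rw [h2, ← map_list_prod, PiTensorProduct.tprodMonoidHom_apply]
  congr 1
  funext j
  refine (map_list_prod (Pi.evalMonoidHom (fun _ : Fin k => TensorAlgebra F V) j) _).trans ?_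
  rw [List.map_ofFn]
  congr 2
  funext i
  simp [Pi.mulSingle_apply, eq_comm]

/-- The multiplication map on `T(V)^{⊗k}`, restricted to the component of multidegree `ν`. -/
noncomputable def mulOfDegree {r : ℕ} (ν : Composition r) :
    (⨂[F] _ : Fin ν.length, TensorAlgebra F V) →ₗ[F] TensorAlgebra F V :=
  PiTensorProduct.lift ((MultilinearMap.mkPiAlgebraFin F ν.length
    (TensorAlgebra F V)).compLinearMap fun j => GradedAlgebra.proj
      (fun i : ℕ => LinearMap.range (TensorAlgebra.ι F : V →ₗ[F] TensorAlgebra F V) ^ i)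
      (ν.blocksFun j))

-- The summand of `f` is homogeneous, of degree the total size assigned to each slot. The projection
-- keeps it when `f` is a filling and kills it otherwise.
open Classical in
lemma mulOfDegree_coproduct {r l : ℕ} (ν : Composition r) {b : Fin l → TensorAlgebra F V}
    {d : Fin l → ℕ} (hb : ∀ i, b i ∈ liePower F V (d i)) :
    mulOfDegree ν (coproduct F V ν.length (List.ofFn b).prod) =
      ∑ f : Fin l → Fin ν.length with IsFilling ν d f, ((blockList f).map b).prod := by
  rw [coproduct_prod fun i => (hb i).2, map_sum, Finset.sum_filter]
  refine Finset.sum_congr rfl fun f _ => ?_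
  have hdeg : ∀ j, (List.ofFn fun i => if f i = j then b i else 1).prod ∈
      LinearMap.range (TensorAlgebra.ι F : V →ₗ[F] TensorAlgebra F V) ^ (∑ i with f i = j, d i) := by
    intro j
    have := SetLike.list_prod_ofFn_mem_graded
      (A := fun i : ℕ => LinearMap.range (TensorAlgebra.ι F : V →ₗ[F] TensorAlgebra F V) ^ i)
      (fun i => if f i = j then d i else 0) (fun i => if f i = j then b i else 1) (fun i => by
        split_ifs
        · exact (hb i).1
        · exact SetLike.GradedOne.one_mem)
    rwa [List.sum_ofFn, ← Finset.sum_filter] at this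
  rw [mulOfDegree, PiTensorProduct.lift.tprod, MultilinearMap.compLinearMap_apply,
    MultilinearMap.mkPiAlgebraFin_apply]
  simp only [GradedAlgebra.proj_apply]
  split_ifs with h
  · rw [← prod_map_blockList]
    congr 2
    funext j
    have := hdeg j
    rw [h j] at this
    exact DirectSum.decompose_of_mem_same _ this
  · unfold IsFilling at h
    push Not at h
    obtain ⟨j, hj⟩ := h
    refine List.prod_eq_zero (List.mem_ofFn.2 ⟨j, ?_⟩)
    exact DirectSum.decompose_of_mem_ne _ (hdeg j) hj

lemma ι_mem_liePower (v : V) : TensorAlgebra.ι F v ∈ liePower F V 1 :=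
  ⟨by rw [pow_one]; exact ⟨v, rfl⟩, LieSubalgebra.subset_lieSpan ⟨v, rfl⟩⟩

/-- The permutations in `X^ν` are the stable sorts of words of content `ν`; `σ` is recovered from
the word `ν.index ∘ σ⁻¹`. -/
lemma increasingOnBlocks_iff_eq_sort {r : ℕ} {ν : Composition r} (σ : Equiv.Perm (Fin r)) :
    IncreasingOnBlocks ν σ ↔ σ = Tuple.sort (ν.index ∘ ⇑σ⁻¹) := by
  rw [Tuple.eq_sort_iff]
  have : (ν.index ∘ ⇑σ⁻¹) ∘ ⇑σ = ν.index := by funext x; simp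
  rw [this]
  constructor
  · intro h
    exact ⟨fun i j hij => index_mono ν hij, fun i j hij hi => h i j hij (by simpa using hi)⟩
  · rintro ⟨-, h⟩ i j hij hi
    exact h i j hij (by simpa using hi)

lemma HasContent.comp_sort {r : ℕ} {ν : Composition r} {g : Fin r → Fin ν.length}
    (h : HasContent ν g) : g ∘ Tuple.sort g = ν.index := by
  obtain ⟨σ, hσ⟩ := h.exists_perm
  have hσ' : g ∘ σ = ν.index := funext hσ
  rw [← hσ']
  refine Tuple.unique_monotone (Tuple.monotone_sort g) ?_
  rw [hσ']
  exact fun i j hij => index_mono ν hij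

/-- On `T^r(V)`, the element `X^ν` acts as the component of multidegree `ν` of the coproduct
followed by multiplication. -/
lemma toTensorAlgebra_descentElt {r : ℕ} (ν : Composition r) (w : ⨂[F]^r V) :
    TensorPower.toTensorAlgebra (tensorAction F V r (descentElt F ν) w) =
      mulOfDegree ν (coproduct F V ν.length (TensorPower.toTensorAlgebra w)) := by
  classical
  suffices h : TensorPower.toTensorAlgebra ∘ₗ (tensorAction F V r (descentElt F ν)) =
      mulOfDegree ν ∘ₗ (coproduct F V ν.length).toLinearMap ∘ₗ TensorPower.toTensorAlgebra from
    LinearMap.congr_fun h w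
  ext v
  simp only [LinearMap.compMultilinearMap_apply, LinearMap.comp_apply, AlgHom.toLinearMap_apply,
    TensorPower.toTensorAlgebra_tprod, TensorAlgebra.tprod_apply]
  -- Vectors are Lie elements of degree `1`, so the fillings here are exactly the words of content
  -- `ν`; sorting matches them with the permutations occurring in `X^ν`.
  rw [mulOfDegree_coproduct ν (d := fun _ => 1) fun i => ι_mem_liePower (v i), descentElt, map_sum,
    LinearMap.sum_apply, map_sum]
  refine Finset.sum_bij' (fun σ _ => ν.index ∘ ⇑σ⁻¹) (fun f _ => Tuple.sort f) ?_ ?_ ?_ ?_ ?_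
  · intro σ _
    rw [Finset.mem_filter, isFilling_one]
    exact ⟨Finset.mem_univ _, (hasContent_index ν).comp_perm _⟩
  · intro f hf
    rw [Finset.mem_filter, isFilling_one] at hf
    rw [Finset.mem_filter, increasingOnBlocks_iff_eq_sort, ← hf.2.comp_sort]
    refine ⟨Finset.mem_univ _, ?_⟩
    congr 1
    funext x
    simp
  · intro σ hσ
    exact ((increasingOnBlocks_iff_eq_sort σ).1 (Finset.mem_filter.1 hσ).2).symm
  · intro f hf
    rw [Finset.mem_filter, isFilling_one] at hf
    rw [← hf.2.comp_sort]
    funext x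
    simp
  · intro σ hσ
    have := (increasingOnBlocks_iff_eq_sort σ).1 (Finset.mem_filter.1 hσ).2
    rw [blockList_eq_ofFn_sort, ← this, tensorAction, MonoidAlgebra.lift_single, one_smul,
      List.map_ofFn]
    change TensorPower.toTensorAlgebra (PiTensorProduct.reindex F (fun _ => V) σ.symm _) = _
    rw [PiTensorProduct.reindex_tprod, TensorPower.toTensorAlgebra_tprod, TensorAlgebra.tprod_apply]
    rfl

end Coproduct

/-! ### The action of the descent algebra on the filtration. -/

section Filtration

attribute [local instance] LieRing.ofAssociativeRing

variable {F : Type*} [Field F] {V : Type*} [AddCommGroup V] [Module F V] {r : ℕ}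

lemma toTensorAlgebra_injective (n : ℕ) :
    Function.Injective (TensorPower.toTensorAlgebra : ⨂[F]^n V →ₗ[F] TensorAlgebra F V) := by
  have h : ∀ w : ⨂[F]^n V, TensorPower.toTensorAlgebra w =
      TensorAlgebra.ofDirectSum (DirectSum.of (fun n => ⨂[F]^n V) n w) := fun w =>
    (DirectSum.toAddMonoid_of
      (fun n => (TensorPower.toTensorAlgebra (R := F) (M := V) (n := n)).toAddMonoidHom) n w).symm
  intro x y hxy
  rw [h, h] at hxy
  have := congrArg TensorAlgebra.toDirectSum hxy
  rw [TensorAlgebra.toDirectSum_ofDirectSum, TensorAlgebra.toDirectSum_ofDirectSum] at this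
  exact DirectSum.of_injective n this

lemma exists_toTensorAlgebra_eq {n : ℕ} {x : TensorAlgebra F V}
    (hx : x ∈ LinearMap.range (TensorAlgebra.ι F : V →ₗ[F] TensorAlgebra F V) ^ n) :
    ∃ w : ⨂[F]^n V, TensorPower.toTensorAlgebra w = x := by
  induction n generalizing x with
  | zero =>
    rw [pow_zero] at hx
    obtain ⟨a, rfl⟩ := Submodule.mem_one.1 hx
    exact ⟨_, TensorPower.toTensorAlgebra_galgebra_toFun a⟩
  | succ n ih =>
    rw [pow_succ] at hx
    induction hx using Submodule.mul_induction_on' with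
    | mem_mul_mem a ha b hb =>
      obtain ⟨w, rfl⟩ := ih ha
      obtain ⟨v, rfl⟩ := hb
      refine ⟨@GradedMonoid.GMul.mul _ (fun n => ⨂[F]^n V) _ _ _ _ w
        (PiTensorProduct.tprod F fun _ : Fin 1 => v), ?_⟩
      rw [TensorPower.toTensorAlgebra_gMul, TensorPower.toTensorAlgebra_tprod,
        TensorAlgebra.tprod_apply]
      simp
    | add a _ b _ ha hb =>
      obtain ⟨w, rfl⟩ := ha
      obtain ⟨w', rfl⟩ := hb
      exact ⟨w + w', map_add _ _ _⟩

/-- All entries `(d, b)` of the list are Lie elements `b` of positive degree `d`. -/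
def IsLieList (L : List (ℕ × TensorAlgebra F V)) : Prop :=
  ∀ x ∈ L, 0 < x.1 ∧ x.2 ∈ liePower F V x.1

/-- Rearrangements and commutators are computed in `T(V)`; this brings the resulting products back
to `T^r(V)`. -/
lemma IsLieList.exists_mem_lieProducts {L : List (ℕ × TensorAlgebra F V)} (hL : IsLieList L)
    {theta : r.Partition} (ht : (L.map Prod.fst : Multiset ℕ) = theta.parts) :
    ∃ w ∈ lieProducts F V theta, TensorPower.toTensorAlgebra w = (L.map Prod.snd).prod := by
  have hsum : (L.map Prod.fst).sum = r := by
    rw [← theta.parts_sum, ← ht, Multiset.sum_coe]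
  let μ : Composition r := ⟨L.map Prod.fst, fun {i} hi => by
    obtain ⟨x, hx, rfl⟩ := List.mem_map.1 hi
    exact (hL x hx).1, hsum⟩
  have hlen : μ.length = L.length := List.length_map _
  have hμ : ∀ i : Fin μ.length, μ.blocksFun i = (L.get (i.cast hlen)).1 := fun i => by
    simp [Composition.blocksFun, μ]
  let b : Fin μ.length → TensorAlgebra F V := fun i => (L.get (i.cast hlen)).2
  have hb : ∀ i, b i ∈ liePower F V (μ.blocksFun i) := fun i => by
    rw [hμ]
    exact (hL _ (List.get_mem _ _)).2
  have hofFn : List.ofFn b = L.map Prod.snd := by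
    refine List.ext_get (by simp [hlen]) fun n h1 h2 => by simp [b]
  have hdeg : (List.ofFn b).prod ∈
      LinearMap.range (TensorAlgebra.ι F : V →ₗ[F] TensorAlgebra F V) ^ r := by
    have := SetLike.list_prod_ofFn_mem_graded
      (A := fun i : ℕ => LinearMap.range (TensorAlgebra.ι F : V →ₗ[F] TensorAlgebra F V) ^ i)
      μ.blocksFun b fun i => (hb i).1
    rwa [μ.ofFn_blocksFun, μ.blocks_sum] at this
  obtain ⟨w, hw⟩ := exists_toTensorAlgebra_eq hdeg
  exact ⟨w, ⟨μ, b, Nat.Partition.ext ht, hb, hw⟩, by rw [hw, hofFn]⟩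

lemma lie_mem_liePower {i j : ℕ} {a b : TensorAlgebra F V} (ha : a ∈ liePower F V i)
    (hb : b ∈ liePower F V j) : a * b - b * a ∈ liePower F V (i + j) := by
  refine ⟨Submodule.sub_mem _ ?_ ?_, LieSubalgebra.lie_mem _ ha.2 hb.2⟩
  · rw [pow_add]
    exact Submodule.mul_mem_mul ha.1 hb.1
  · rw [add_comm, pow_add]
    exact Submodule.mul_mem_mul hb.1 ha.1

/-- Modulo `W_{lam+}`, the factors of a product of Lie elements may be reordered. -/
lemma prod_sub_prod_mem_of_perm {lam : r.Partition} {L M : List (ℕ × TensorAlgebra F V)}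
    (h : L.Perm M) : ∀ P Q : List (ℕ × TensorAlgebra F V), IsLieList (P ++ L ++ Q) →
      ((P ++ L ++ Q).map Prod.fst : Multiset ℕ) = lam.parts →
      ((P ++ L ++ Q).map Prod.snd).prod - ((P ++ M ++ Q).map Prod.snd).prod ∈
        (pbwWPlus F V lam).map TensorPower.toTensorAlgebra := by
  induction h with
  | nil => intro P Q _ _; rw [sub_self]; exact Submodule.zero_mem _
  | cons x _ ih =>
    intro P Q hL hp
    -- The common head is absorbed into the prefix, which is why the statement carries arbitrary `P`
    -- and `Q`.
    have := ih (P ++ [x]) Q (by simpa using hL) (by simpa using hp)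
    simpa using this
  | swap x y L =>
    intro P Q hL hp
    have hx : 0 < x.1 ∧ x.2 ∈ liePower F V x.1 := hL x (by simp)
    have hy : 0 < y.1 ∧ y.2 ∈ liePower F V y.1 := hL y (by simp)
    -- The two products differ by the product with `y, x` replaced by their commutator `z`. Its
    -- partition `theta` merges two parts of `lam`, hence is lexicographically larger.
    let z : ℕ × TensorAlgebra F V := (y.1 + x.1, y.2 * x.2 - x.2 * y.2)
    have hz : IsLieList (P ++ z :: L ++ Q) := by
      intro u hu
      simp only [List.mem_append, List.mem_cons] at hu
      rcases hu with (hu | rfl | hu) | hu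
      · exact hL u (by simp [hu])
      · exact ⟨by simp only [z]; omega, lie_mem_liePower hy.2 hx.2⟩
      · exact hL u (by simp [hu])
      · exact hL u (by simp [hu])
    let s : Multiset ℕ := ((P ++ L ++ Q).map Prod.fst : List ℕ)
    have hl : lam.parts = y.1 ::ₘ x.1 ::ₘ s := by
      rw [← hp]
      simp only [s, Multiset.cons_coe, Multiset.coe_eq_coe, ← List.map_cons]
      refine List.Perm.map _ ?_
      simp only [List.append_assoc, List.cons_append]
      refine List.perm_middle.trans (List.Perm.cons _ ?_)
      exact List.perm_middle
    have hzs : ((P ++ z :: L ++ Q).map Prod.fst : Multiset ℕ) = (y.1 + x.1) ::ₘ s := by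
      have : y.1 + x.1 = z.1 := rfl
      rw [this]
      simp only [s, Multiset.cons_coe, Multiset.coe_eq_coe, ← List.map_cons]
      refine List.Perm.map _ ?_
      simp only [List.append_assoc, List.cons_append]
      exact List.perm_middle
    let theta : r.Partition := ⟨(y.1 + x.1) ::ₘ s, by
      intro i hi
      rcases Multiset.mem_cons.1 hi with rfl | hi
      · omega
      · exact lam.parts_pos (by rw [hl]; exact Multiset.mem_cons_of_mem (Multiset.mem_cons_of_mem hi)),
      by
        have := lam.parts_sum
        rw [hl, Multiset.sum_cons, Multiset.sum_cons] at this
        rw [Multiset.sum_cons]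
        omega⟩
    obtain ⟨w, hw, hw'⟩ := hz.exists_mem_lieProducts (theta := theta) hzs
    refine ⟨w, Submodule.subset_span ⟨theta, lexLT_of_merge hy.1 hx.1 hl rfl, hw⟩, ?_⟩
    rw [hw']
    simp only [List.map_append, List.map_cons, List.prod_append, List.prod_cons, z]
    noncomm_ring
  | trans h1 _ ih1 ih2 =>
    intro P Q hL hp
    have hperm := (h1.append_left P).append_right Q
    have := Submodule.add_mem _ (ih1 P Q hL hp) (ih2 P Q (fun x hx => hL x (hperm.mem_iff.2 hx))
      (by rw [← hp]; exact Multiset.coe_eq_coe.2 (hperm.symm.map _)))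
    simpa using this

/-- The image of `w` is a sum over fillings of reorderings of the product `w`. There are `youngChar
ν σ` of them, and each is congruent to `w`. -/
lemma descentElt_sub_mem {lam : r.Partition} (ν : Composition r) {σ : Equiv.Perm (Fin r)}
    (hσ : cyclePartition σ = lam) {w : ⨂[F]^r V} (hw : w ∈ lieProducts F V lam) :
    tensorAction F V r (descentElt F ν) w - (youngChar ν σ : F) • w ∈ pbwWPlus F V lam := by
  classical
  obtain ⟨μ, b, hμ, hb, hw⟩ := hw
  have hparts : Finset.univ.val.map μ.blocksFun = (cyclePartition σ).parts := by
    rw [hσ, ← hμ]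
    change _ = (μ.blocks : Multiset ℕ)
    rw [Fin.univ_val_map, μ.ofFn_blocksFun]
  -- The membership is transported to `T(V)`, and the multiple of `w` is written as a constant sum
  -- over the fillings, to be compared term by term.
  rw [← Submodule.comap_map_eq_of_injective (toTensorAlgebra_injective r) (pbwWPlus F V lam), Submodule.mem_comap,
    map_sub, map_smul, toTensorAlgebra_descentElt, hw, mulOfDegree_coproduct ν hb,
    youngChar_eq_card_fillings ν σ _ hparts, Nat.card_eq_fintype_card, Fintype.card_subtype,
    Nat.cast_smul_eq_nsmul, ← Finset.sum_const, ← Finset.sum_sub_distrib]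
  refine Submodule.sum_mem _ fun f _ => ?_
  have h := prod_sub_prod_mem_of_perm (lam := lam)
    ((blockList_perm f).map fun i => (μ.blocksFun i, b i)) [] []
  simp only [List.nil_append, List.append_nil, List.map_map] at h
  rw [List.ofFn_eq_map]
  refine h ?_ ?_
  · intro x hx
    obtain ⟨i, -, rfl⟩ := List.mem_map.1 hx
    exact ⟨μ.one_le_blocksFun i, hb i⟩
  · rw [← hμ]
    change _ = (μ.blocks : Multiset ℕ)
    rw [Multiset.coe_eq_coe]
    refine ((blockList_perm f).map _).trans (List.Perm.of_eq ?_)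
    rw [← μ.ofFn_blocksFun, List.ofFn_eq_map]
    rfl

lemma pbwW_le_pbwWPlus {lam theta : r.Partition} (h : LexLT lam theta) :
    pbwW F V theta ≤ pbwWPlus F V lam :=
  Submodule.span_mono fun _ ⟨eta, he, hw⟩ => ⟨eta, h.trans_le he, hw⟩

lemma pbwWPlus_le_pbwW (lam : r.Partition) : pbwWPlus F V lam ≤ pbwW F V lam :=
  Submodule.span_mono fun _ ⟨eta, he, hw⟩ => ⟨eta, Or.inr he, hw⟩

lemma pbwWPlus_le {lam : r.Partition} {S : Submodule F (⨂[F]^r V)}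
    (h : ∀ theta, LexLT lam theta → pbwW F V theta ≤ S) : pbwWPlus F V lam ≤ S :=
  Submodule.span_le.2 fun _ ⟨theta, ht, hw⟩ =>
    h theta ht (Submodule.subset_span ⟨theta, Or.inl rfl, hw⟩)

lemma descentElt_mem_pbwW (ν : Composition r) (lam : r.Partition) {w : ⨂[F]^r V}
    (hw : w ∈ pbwW F V lam) : tensorAction F V r (descentElt F ν) w ∈ pbwW F V lam := by
  have : pbwW F V lam ≤ (pbwW F V lam).comap (tensorAction F V r (descentElt F ν)) := by
    refine Submodule.span_le.2 ?_
    rintro x ⟨theta, ht, hx⟩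
    obtain ⟨σ, hσ⟩ := exists_cyclePartition_eq theta
    have h1 := descentElt_sub_mem ν hσ hx
    have h2 : pbwW F V theta ≤ pbwW F V lam := by
      rcases ht with rfl | ht
      · exact le_rfl
      · exact (pbwW_le_pbwWPlus ht).trans (pbwWPlus_le_pbwW lam)
    have hx' : x ∈ pbwW F V theta := Submodule.subset_span ⟨theta, Or.inl rfl, hx⟩
    have := Submodule.add_mem _ (h2 (pbwWPlus_le_pbwW _ h1))
      (Submodule.smul_mem _ (youngChar ν σ : F) (h2 hx'))
    rwa [sub_add_cancel] at this
  exact this hw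

lemma descentElt_mem_pbwWPlus (ν : Composition r) (lam : r.Partition) {w : ⨂[F]^r V}
    (hw : w ∈ pbwWPlus F V lam) : tensorAction F V r (descentElt F ν) w ∈ pbwWPlus F V lam := by
  have : pbwWPlus F V lam ≤ (pbwWPlus F V lam).comap (tensorAction F V r (descentElt F ν)) :=
    pbwWPlus_le fun theta ht x hx => pbwW_le_pbwWPlus ht (descentElt_mem_pbwW ν theta hx)
  exact this hw

/-- The descent algebra acts on `W_lam / W_{lam+}` by the scalars given by `charMap`. -/
lemma descentAlg_sub_mem (d : descentAlg F r) {lam : r.Partition} {σ : Equiv.Perm (Fin r)}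
    (hσ : cyclePartition σ = lam) {w : ⨂[F]^r V} (hw : w ∈ pbwW F V lam) :
    tensorAction F V r d w - charMap F r d σ • w ∈ pbwWPlus F V lam := by
  have hbase : ∀ ν : Composition r, ∀ w ∈ pbwW F V lam,
      tensorAction F V r (descentElt F ν) w - (youngChar ν σ : F) • w ∈ pbwWPlus F V lam := by
    intro ν
    suffices h : pbwW F V lam ≤ (pbwWPlus F V lam).comap
        (tensorAction F V r (descentElt F ν) - (youngChar ν σ : F) • LinearMap.id) from
      fun w hw => h hw
    refine Submodule.span_le.2 ?_
    rintro x ⟨theta, rfl | ht, hx⟩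
    · exact descentElt_sub_mem ν hσ hx
    · have hx' : x ∈ pbwWPlus F V lam := Submodule.subset_span ⟨theta, ht, hx⟩
      exact Submodule.sub_mem _ (descentElt_mem_pbwWPlus ν lam hx') (Submodule.smul_mem _ _ hx')
  -- With `w` fixed, the class of the difference is linear in `d`, so its vanishing can be checked
  -- on the basis `X^ν`.
  let f : descentAlg F r →ₗ[F] (⨂[F]^r V) ⧸ pbwWPlus F V lam :=
    (pbwWPlus F V lam).mkQ ∘ₗ (LinearMap.applyₗ w ∘ₗ (tensorAction F V r).toLinearMap ∘ₗ
      (descentAlg F r).subtype - (LinearMap.toSpanSingleton F _ w ∘ₗ LinearMap.proj σ ∘ₗ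
        charMap F r))
  have hf : ∀ d : descentAlg F r, f d =
      (pbwWPlus F V lam).mkQ (tensorAction F V r d w - charMap F r d σ • w) := fun d => rfl
  have h0 : f = 0 := by
    refine (descentBasis F r).ext fun ν => ?_
    have hν : (descentBasis F r ν : MonoidAlgebra F (Sym r)) = descentElt F ν :=
      congrArg Subtype.val (Module.Basis.span_apply (descentElt_linearIndependent F r) ν)
    rw [hf, hν, charMap, Module.Basis.constr_basis, LinearMap.zero_apply, Submodule.mkQ_apply,
      Submodule.Quotient.mk_eq_zero]
    exact hbase ν w hw
  have := hf d
  rw [h0, LinearMap.zero_apply, eq_comm, Submodule.mkQ_apply, Submodule.Quotient.mk_eq_zero] at this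
  exact this

lemma tprod_mem_pbwW (v : Fin r → V) :
    PiTensorProduct.tprod F v ∈
      pbwW F V (Nat.Partition.ofComposition r (Composition.ones r)) := by
  refine Submodule.subset_span ⟨_, Or.inl rfl, Composition.ones r,
    fun i => TensorAlgebra.ι F (v (i.cast (Composition.ones_length r))), rfl, fun i => ?_, ?_⟩
  · rw [Composition.ones_blocksFun]
    exact ι_mem_liePower _
  · rw [TensorPower.toTensorAlgebra_tprod, TensorAlgebra.tprod_apply]
    congr 1
    exact List.ofFn_congr (Composition.ones_length r).symm _

/-- Each pure tensor is a product of `r` Lie elements of degree `1`, so the term of the partition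
`(1^r)` is the whole space. -/
lemma pbwW_ones :
    pbwW F V (Nat.Partition.ofComposition r (Composition.ones r)) = ⊤ := by
  rw [eq_top_iff, ← PiTensorProduct.span_tprod_eq_top, Submodule.span_le]
  rintro _ ⟨v, rfl⟩
  exact tprod_mem_pbwW v

end Filtration

/-! ### Triangularity on lifted bases. -/

section LiftedBases

variable {F : Type*} [Field F] {V : Type*} [AddCommGroup V] [Module F V] {r : ℕ}

lemma IsLiftedBasis.eq_zero_of_sum_mem {lam : r.Partition} {Y : Set (⨂[F]^r V)}
    (hY : IsLiftedBasis lam Y) {s : Finset (⨂[F]^r V)} (hs : ∀ y ∈ s, y ∈ Y)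
    {g : (⨂[F]^r V) → F} (hg : ∑ y ∈ s, g y • y ∈ pbwWPlus F V lam) : ∀ y ∈ s, g y = 0 := by
  classical
  intro y hy
  refine linearIndependent_iff'.1 hY.linearIndependent (s.subtype (· ∈ Y)) (fun y => g y) ?_
    ⟨y, hs y hy⟩ (by simpa using hy)
  simp only [← map_smul, ← map_sum]
  rw [Submodule.mkQ_apply, Submodule.Quotient.mk_eq_zero, Submodule.submoduleOf, Submodule.mem_comap,
    map_sum]
  simp only [map_smul, Submodule.subtype_apply]
  rwa [Finset.sum_subtype_of_mem (fun y => g y • y) hs]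

lemma IsLiftedBasis.le_span_sup {lam : r.Partition} {Y : Set (⨂[F]^r V)}
    (hY : IsLiftedBasis lam Y) : pbwW F V lam ≤ Submodule.span F Y ⊔ pbwWPlus F V lam := by
  intro w hw
  have h : ((pbwWPlus F V lam).submoduleOf (pbwW F V lam)).mkQ ⟨w, hw⟩ ∈
      Submodule.span F (Set.range fun y : Y =>
        ((pbwWPlus F V lam).submoduleOf (pbwW F V lam)).mkQ ⟨y, hY.subset y.2⟩) := by
    rw [hY.span_eq_top]
    trivial
  have hr : (Set.range fun y : Y =>
        ((pbwWPlus F V lam).submoduleOf (pbwW F V lam)).mkQ ⟨y, hY.subset y.2⟩) =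
      ((pbwWPlus F V lam).submoduleOf (pbwW F V lam)).mkQ ''
        (Set.range fun y : Y => (⟨y, hY.subset y.2⟩ : pbwW F V lam)) := by
    rw [← Set.range_comp]
    rfl
  rw [hr, ← Submodule.map_span] at h
  obtain ⟨u, hu, huw⟩ := h
  have hu' : (u : ⨂[F]^r V) ∈ Submodule.span F Y := by
    have : Submodule.span F (Set.range fun y : Y => (⟨y, hY.subset y.2⟩ : pbwW F V lam)) ≤
        (Submodule.span F Y).comap (pbwW F V lam).subtype := by
      refine Submodule.span_le.2 ?_
      rintro _ ⟨y, rfl⟩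
      exact Submodule.subset_span y.2
    exact this hu
  have hsub : w - u ∈ pbwWPlus F V lam :=
    (Submodule.Quotient.eq ((pbwWPlus F V lam).submoduleOf (pbwW F V lam))).1 huw.symm
  rw [← add_sub_cancel (u : ⨂[F]^r V) w]
  exact Submodule.add_mem_sup hu' hsub

variable {p : ℕ} {E : Module.End F (⨂[F]^r V)} {J : PClass p r} {Y : r.Partition → Set (⨂[F]^r V)}

/-- In a nontrivial relation, take the lexicographically least `lam` among the partitions of the
vectors with nonzero coefficient. Modulo `W_{lam+}` only the vectors of `Y lam` survive and `E`
fixes their cosets, which contradicts their independence. -/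
lemma linearIndepOn_classUnion (hY : ∀ lam, IsLiftedBasis lam (Y lam))
    (h1 : ∀ lam, PClass.mk p lam = J → ∀ w ∈ pbwW F V lam, E w - w ∈ pbwWPlus F V lam) :
    LinearIndepOn F E (classUnion Y J) := by
  classical
  rw [linearIndepOn_iff']
  intro s g hs hsum
  by_contra hne
  push Not at hne
  -- Any partition in `J` whose set contains `y` may serve as its degree; disjointness of the sets
  -- is not needed.
  have hdeg : ∀ y : s, ∃ lam, PClass.mk p lam = J ∧ (y : ⨂[F]^r V) ∈ Y lam := fun y => by
    have := hs y.2
    simp only [classUnion, Set.mem_iUnion, exists_prop] at this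
    exact this
  choose deg hdegJ hdegY using hdeg
  let t : Finset s := Finset.univ.filter fun y => g y ≠ 0
  obtain ⟨y₀, hy₀, hgy₀⟩ := hne
  have ht : (t.image deg).Nonempty := ⟨deg ⟨y₀, hy₀⟩, Finset.mem_image_of_mem _ (by simp [t, hgy₀])⟩
  obtain ⟨lam, hlam, hmin⟩ := exists_lex_min _ ht
  obtain ⟨y₁, hy₁, hdy₁⟩ := Finset.mem_image.1 hlam
  have hsum' : ∑ y ∈ t, g y • E y = 0 := by
    rw [← hsum, ← Finset.sum_coe_sort s]
    exact Finset.sum_filter_of_ne fun y _ h hg => h (by rw [hg, zero_smul])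
  let u : Finset s := t.filter fun y => deg y = lam
  have hu : ∑ y ∈ u, g y • (y : ⨂[F]^r V) ∈ pbwWPlus F V lam := by
    rw [← Finset.sum_filter_add_sum_filter_not t fun y => deg y = lam] at hsum'
    -- By minimality the other vectors have larger degree, so their images under `E` lie in
    -- `W_{lam+}`.
    have hA : ∑ y ∈ t with ¬ deg y = lam, g y • E y ∈ pbwWPlus F V lam := by
      refine Submodule.sum_mem _ fun y hy => Submodule.smul_mem _ _ ?_
      rw [Finset.mem_filter] at hy
      have hlt := hmin _ (Finset.mem_image_of_mem _ hy.1) hy.2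
      have hyW := (hY (deg y)).subset (hdegY y)
      have := Submodule.add_mem _ (pbwWPlus_le_pbwW _ (h1 _ (hdegJ y) _ hyW)) hyW
      rw [sub_add_cancel] at this
      exact pbwW_le_pbwWPlus hlt this
    have hB : ∑ y ∈ u, g y • (E y - y) ∈ pbwWPlus F V lam := by
      refine Submodule.sum_mem _ fun y hy => Submodule.smul_mem _ _ ?_
      rw [Finset.mem_filter] at hy
      have := h1 _ (hdegJ y) _ ((hY (deg y)).subset (hdegY y))
      rwa [hy.2] at this
    simp only [smul_sub, Finset.sum_sub_distrib] at hB
    rw [eq_neg_of_add_eq_zero_left hsum'] at hB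
    have := Submodule.neg_mem _ (Submodule.add_mem _ hB hA)
    simpa using this
  have hz := (hY lam).eq_zero_of_sum_mem (s := u.map (Function.Embedding.subtype _)) (g := g)
    (fun y hy => by
      obtain ⟨z, hz, rfl⟩ := Finset.mem_map.1 hy
      have := hdegY z
      rwa [(Finset.mem_filter.1 hz).2] at this)
    (by rw [Finset.sum_map]; exact hu)
  exact (Finset.mem_filter.1 hy₁).2
    (hz y₁ (Finset.mem_map_of_mem _ (Finset.mem_filter.2 ⟨hy₁, hdy₁⟩)))

lemma span_image_classUnion (hY : ∀ lam, IsLiftedBasis lam (Y lam)) (hE : ∀ w, E (E w) = E w)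
    (h0 : ∀ lam, PClass.mk p lam ≠ J → ∀ w ∈ pbwW F V lam, E w ∈ pbwWPlus F V lam) :
    Submodule.span F (E '' classUnion Y J) = LinearMap.range E := by
  refine le_antisymm (Submodule.span_le.2 ?_) ?_
  · rintro _ ⟨y, -, rfl⟩
    exact ⟨y, rfl⟩
  · have key : ∀ lam, pbwW F V lam ≤ (Submodule.span F (E '' classUnion Y J)).comap E := by
      refine lex_induction fun lam ih => ?_
      have hplus := pbwWPlus_le ih
      by_cases hJ : PClass.mk p lam = J
      · refine (hY lam).le_span_sup.trans (sup_le (Submodule.span_le.2 fun y hy => ?_) hplus)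
        refine Submodule.subset_span ⟨y, ?_, rfl⟩
        simp only [classUnion, Set.mem_iUnion, exists_prop]
        exact ⟨lam, hJ, hy⟩
      -- Outside `J`, `E w` drops into `W_{lam+}`, where the induction hypothesis puts `E (E w)` in
      -- the span; this equals `E w` by idempotency.
      · intro w hw
        have := hplus (h0 lam hJ w hw)
        rwa [Submodule.mem_comap, hE] at this
    rintro _ ⟨w, rfl⟩
    exact key _ (by rw [pbwW_ones]; trivial)

end LiftedBases

end DescentPBW

/-! ### The proposition. -/

open DescentPBW in
theorem proposition3p5 (p : ℕ) [Fact p.Prime] (F : Type*) [Field F] [CharP F p]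
    (V : Type*) [AddCommGroup V] [Module F V] (r : ℕ) (hr : 0 < r)
    (e : DescentPBW.PClass p r → DescentPBW.descentAlg F r)
    (he : DescentPBW.IsDescentIdempotents e)
    (Y : r.Partition → Set (⨂[F]^r V)) (hY : ∀ lam, DescentPBW.IsLiftedBasis lam (Y lam))
    (J : DescentPBW.PClass p r) :
    LinearIndependent F (fun y : DescentPBW.classUnion Y J => (y : ⨂[F]^r V)) ∧
    (∃ f : Submodule.span F (DescentPBW.classUnion Y J) ≃ₗ[F]
        LinearMap.range (DescentPBW.tensorAction F V r (e J)),
      ∀ w, (f w : ⨂[F]^r V) = DescentPBW.tensorAction F V r (e J) w) ∧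
    ∃ b : Module.Basis (DescentPBW.classUnion Y J) F
        (LinearMap.range (DescentPBW.tensorAction F V r (e J))),
      ∀ y, (b y : ⨂[F]^r V) = DescentPBW.tensorAction F V r (e J) y := by
  set E := tensorAction F V r (e J) with hEdef
  have hE : ∀ w, E (E w) = E w := fun w => by
    rw [← Module.End.mul_apply, hEdef, ← map_mul, (he.primitive J).2.1]
  have h1 : ∀ lam, PClass.mk p lam = J → ∀ w ∈ pbwW F V lam, E w - w ∈ pbwWPlus F V lam := by
    intro lam hJ w hw
    obtain ⟨σ, hσ⟩ := exists_cyclePartition_eq lam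
    have := descentAlg_sub_mem (e J) hσ hw
    rwa [he.charMap_eq, hσ, if_pos hJ, one_smul] at this
  have h0 : ∀ lam, PClass.mk p lam ≠ J → ∀ w ∈ pbwW F V lam, E w ∈ pbwWPlus F V lam := by
    intro lam hJ w hw
    obtain ⟨σ, hσ⟩ := exists_cyclePartition_eq lam
    have := descentAlg_sub_mem (e J) hσ hw
    rwa [he.charMap_eq, hσ, if_neg hJ, zero_smul, sub_zero] at this
  have hli : LinearIndependent F (fun y : classUnion Y J => E y) := linearIndepOn_classUnion hY h1
  have hspan : Submodule.span F (Set.range fun y : classUnion Y J => E y) = LinearMap.range E := by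
    rw [← span_image_classUnion hY hE h0, Set.image_eq_range]
  -- A relation among the `y` would map under `E` to one among the `E y`.
  have hliY : LinearIndependent F (fun y : classUnion Y J => (y : ⨂[F]^r V)) :=
    LinearIndependent.of_comp E hli
  have hspanY : Submodule.span F (Set.range fun y : classUnion Y J => (y : ⨂[F]^r V)) =
      Submodule.span F (classUnion Y J) := by
    rw [Subtype.range_coe]
  let b := (Module.Basis.span hli).map (LinearEquiv.ofEq _ _ hspan)
  have hb : ∀ y, (b y : ⨂[F]^r V) = E y := fun y => by
    rw [Module.Basis.map_apply, LinearEquiv.coe_ofEq_apply]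
    exact congrArg Subtype.val (Module.Basis.span_apply hli y)
  let bY := (Module.Basis.span hliY).map (LinearEquiv.ofEq _ _ hspanY)
  have hbY : ∀ y, (bY y : ⨂[F]^r V) = y := fun y => by
    rw [Module.Basis.map_apply, LinearEquiv.coe_ofEq_apply]
    exact congrArg Subtype.val (Module.Basis.span_apply hliY y)
  -- The isomorphism matches the basis vector `y` with `E y`; it agrees with `E` on a basis, hence
  -- everywhere on the span.
  refine ⟨hliY, ⟨bY.equiv b (Equiv.refl _), fun w => ?_⟩, b, hb⟩
  have hext : (LinearMap.range E).subtype ∘ₗ (bY.equiv b (Equiv.refl _)).toLinearMap =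
      E ∘ₗ (Submodule.span F (classUnion Y J)).subtype := by
    refine bY.ext fun y => ?_
    simp only [LinearMap.comp_apply, LinearEquiv.coe_coe, Module.Basis.equiv_apply,
      Equiv.refl_apply, Submodule.subtype_apply, hb, hbY]
  exact LinearMap.congr_fun hext w
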